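/- Let $n\ge 1$, let $\Omega\subset\mathbb{R}^n$ be a bounded open set and let $c\in\mathbb{R}$. For a real symmetric $n\times n$ matrix $A$ with eigenvalues $\lambda_1,\dots,\lambda_n$ (counted with multiplicity) put $F(A)=\sum_{i=1}^n\arctan\lambda_i$. A function $u$ is a viscosity subsolution of the special Lagrangian equation $F(D^2u)=c$ in $\Omega$ if $F(D^2\varphi(x))\ge c$ whenever $x\in\Omega$, $\varphi$ is $C^2$ near $x$ and $u-\varphi$ has a local maximum at $x$; a function $v$ is a viscosity supersolution if $F(D^2\varphi(x))\le c$ whenever $x\in\Omega$, $\varphi$ is $C^2$ near $x$ and $v-\varphi$ has a local minimum at $x$. Let $u:\overline\Omega\to\mathbb{R}$ be an upper semicontinuous function that is a viscosity subsolution of $F(D^2u)=c$ in $\Omega$, and let $v:\overline\Omega\to\mathbb{R}$ be a lower semicontinuous function that is a viscosity supersolution of $F(D^2v)=c$ in $\Omega$. If $u\le v$ on $\partial\Omega$, then $u\le v$ in $\Omega$. -/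

import Mathlib

open Set Topology

namespace SpecialLagrangian

/-- The Hessian matrix `D²φ(x)`, with entries the second partial derivatives of `φ` at `x`. -/
noncomputable def hessian {n : ℕ} (φ : EuclideanSpace ℝ (Fin n) → ℝ)
    (x : EuclideanSpace ℝ (Fin n)) : Matrix (Fin n) (Fin n) ℝ :=
  Matrix.of fun i j =>
    fderiv ℝ (fderiv ℝ φ) x (EuclideanSpace.single i 1) (EuclideanSpace.single j 1)

/-- The operator `F(A) = ∑ i, arctan λ_i`, where the `λ_i` are the (real) eigenvalues of `A`,
repeated according to algebraic multiplicity. It is only used for symmetric `A`; see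
`phase_eq_sum_eigenvalues`. -/
noncomputable def phase {n : ℕ} (A : Matrix (Fin n) (Fin n) ℝ) : ℝ :=
  (A.charpoly.roots.map Real.arctan).sum

/-- `u` is a viscosity subsolution of `∑ i, arctan λ_i(D²u) = c` in the open set `Ω`: whenever
`φ` is of class `C²` near `x ∈ Ω` and `u - φ` has a local maximum at `x`, `F(D²φ(x)) ≥ c`. -/
def IsViscositySubsolution {n : ℕ} (c : ℝ) (Ω : Set (EuclideanSpace ℝ (Fin n)))
    (u : EuclideanSpace ℝ (Fin n) → ℝ) : Prop :=
  ∀ x ∈ Ω, ∀ φ : EuclideanSpace ℝ (Fin n) → ℝ, ContDiffAt ℝ 2 φ x →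
    IsLocalMax (fun y => u y - φ y) x → c ≤ phase (hessian φ x)

/-- `v` is a viscosity supersolution of `∑ i, arctan λ_i(D²v) = c` in the open set `Ω`: whenever
`φ` is of class `C²` near `x ∈ Ω` and `v - φ` has a local minimum at `x`, `F(D²φ(x)) ≤ c`. -/
def IsViscositySupersolution {n : ℕ} (c : ℝ) (Ω : Set (EuclideanSpace ℝ (Fin n)))
    (v : EuclideanSpace ℝ (Fin n) → ℝ) : Prop :=
  ∀ x ∈ Ω, ∀ φ : EuclideanSpace ℝ (Fin n) → ℝ, ContDiffAt ℝ 2 φ x →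
    IsLocalMin (fun y => v y - φ y) x → phase (hessian φ x) ≤ c

theorem phase_eq_sum_eigenvalues {n : ℕ} {A : Matrix (Fin n) (Fin n) ℝ} (hA : A.IsHermitian) :
    phase A = ∑ i, Real.arctan (hA.eigenvalues i) := by
  unfold phase
  rw [hA.roots_charpoly_eq_eigenvalues]
  simp [List.sum_ofFn]

theorem hessian_isHermitian {n : ℕ} {φ : EuclideanSpace ℝ (Fin n) → ℝ}
    {x : EuclideanSpace ℝ (Fin n)} (h : ContDiffAt ℝ 2 φ x) : (hessian φ x).IsHermitian := by
  have hs : IsSymmSndFDerivAt ℝ φ x := h.isSymmSndFDerivAt (by simp)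
  ext i j
  simpa [hessian] using hs.eq _ _

end SpecialLagrangian

/-!
If `u x₀ > v x₀`, then `f = u + η/2 ‖·‖²` and `g = -v` still satisfy `f + g < a` on `∂Ω` and
`f + g > a` at `x₀`, for small `η > 0` and some `a`. The sup-convolutions `F` and `G` of `f` and `g`
over the closure of `Ω` are semiconvex, and `F + G` has a supergradient at some point for every
slope `p`. Jensen's lemma gives a small slope whose touching point is one of twice differentiability
of both `F` and `G`. There `D²F + D²G ≤ 0`, and the expansions of `F` and `G` transfer to `f` and
`g` at the points `y`, `y'` where the sup-convolutions are attained; these lie in `Ω` because the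
penalization is strong. Hence test functions `φ` for `u` at `y` and `ψ` for `v` at `y'` with
`D²φ(y) < D²ψ(y')`, which contradicts the strict monotonicity of `∑ arctan λ_i` in the eigenvalues.
-/

namespace SpecialLagrangian

open Filter MeasureTheory Metric Module
open scoped RealInnerProductSpace Pointwise

section Eigenvalues

variable {E : Type*} [NormedAddCommGroup E] [InnerProductSpace ℝ E] [FiniteDimensional ℝ E]

theorem exists_ne_zero_forall_inner_eq_zero {ι : Type*} [Fintype ι] (v : ι → E)
    (hι : Fintype.card ι < finrank ℝ E) : ∃ x ≠ 0, ∀ i, ⟪v i, x⟫ = 0 := by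
  have hker : LinearMap.ker (LinearMap.pi fun i => innerₗ E (v i)) ≠ ⊥ :=
    LinearMap.ker_ne_bot_of_finrank_lt (by rwa [finrank_fintype_fun_eq_card])
  obtain ⟨x, hx, hx0⟩ := Submodule.exists_mem_ne_zero_of_ne_bot hker
  exact ⟨x, hx0, congrFun hx⟩

theorem inner_apply_self_eq_sum_eigenvalues {T : E →ₗ[ℝ] E} (hT : T.IsSymmetric) {m : ℕ}
    (hm : finrank ℝ E = m) (x : E) :
    ⟪T x, x⟫ = ∑ i, hT.eigenvalues hm i * ⟪hT.eigenvectorBasis hm i, x⟫ ^ 2 := by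
  rw [← (hT.eigenvectorBasis hm).sum_inner_mul_inner]
  refine Finset.sum_congr rfl fun i _ => ?_
  rw [hT, hT.apply_eigenvectorBasis, RCLike.ofReal_real_eq_id, id, real_inner_smul_right,
    real_inner_comm]
  ring

theorem eigenvalues_lt_eigenvalues {T T' : E →ₗ[ℝ] E} (hT : T.IsSymmetric) (hT' : T'.IsSymmetric)
    (hlt : ∀ x ≠ 0, ⟪T x, x⟫ < ⟪T' x, x⟫) {m : ℕ} (hm : finrank ℝ E = m) (i : Fin m) :
    hT.eigenvalues hm i < hT'.eigenvalues hm i := by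
  set b := hT.eigenvectorBasis hm
  set b' := hT'.eigenvectorBasis hm
  -- The span of `b j`, `j ≤ i`, meets the span of `b' j`, `i ≤ j`: this imposes only `m - 1`
  -- linear conditions.
  obtain ⟨x, hx0, hx⟩ := exists_ne_zero_forall_inner_eq_zero
    (fun j : {j // j ≠ i} => if i < j.1 then b j else b' j)
    ((Fintype.card_subtype_lt (x := i) (by simp)).trans_eq (by simp [hm]))
  have hb (j) (hj : i < j) : ⟪b j, x⟫ = 0 := by simpa [hj] using hx ⟨j, hj.ne'⟩
  have hb' (j) (hj : j < i) : ⟪b' j, x⟫ = 0 := by simpa [hj.not_gt] using hx ⟨j, hj.ne⟩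
  have hlower : hT.eigenvalues hm i * ‖x‖ ^ 2 ≤ ⟪T x, x⟫ := by
    rw [inner_apply_self_eq_sum_eigenvalues hT hm, ← b.sum_sq_inner_right, Finset.mul_sum]
    refine Finset.sum_le_sum fun j _ => ?_
    obtain hj | hj := le_or_gt j i
    · exact mul_le_mul_of_nonneg_right (hT.eigenvalues_antitone hm hj) (sq_nonneg _)
    · simp [b, hb j hj]
  have hupper : ⟪T' x, x⟫ ≤ hT'.eigenvalues hm i * ‖x‖ ^ 2 := by
    rw [inner_apply_self_eq_sum_eigenvalues hT' hm, ← b'.sum_sq_inner_right, Finset.mul_sum]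
    refine Finset.sum_le_sum fun j _ => ?_
    obtain hj | hj := le_or_gt i j
    · exact mul_le_mul_of_nonneg_right (hT'.eigenvalues_antitone hm hj) (sq_nonneg _)
    · simp [b', hb' j hj]
  exact lt_of_mul_lt_mul_right ((hlower.trans_lt (hlt x hx0)).trans_le hupper) (sq_nonneg _)

end Eigenvalues

theorem phase_lt_phase {n : ℕ} (hn : 0 < n) {A B : Matrix (Fin n) (Fin n) ℝ}
    (hA : A.IsHermitian) (hB : B.IsHermitian) (hAB : (B - A).PosDef) : phase A < phase B := by
  rw [phase_eq_sum_eigenvalues hA, phase_eq_sum_eigenvalues hB]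
  have : Nonempty (Fin n) := Fin.pos_iff_nonempty.1 hn
  refine Finset.sum_lt_sum_of_nonempty Finset.univ_nonempty fun i _ => Real.arctan_strictMono <|
    eigenvalues_lt_eigenvalues _ _ (fun x hx => ?_) _ _
  have hpos : 0 < x.ofLp ⬝ᵥ ((B - A).mulVec x.ofLp) :=
    hAB.dotProduct_mulVec_pos ((WithLp.ofLp_eq_zero 2).not.2 hx)
  rw [Matrix.sub_mulVec, dotProduct_sub] at hpos
  exact sub_pos.1 hpos

theorem dotProduct_hessian_mulVec {n : ℕ} (φ : EuclideanSpace ℝ (Fin n) → ℝ)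
    (y x : EuclideanSpace ℝ (Fin n)) :
    x.ofLp ⬝ᵥ (hessian φ y).mulVec x.ofLp = fderiv ℝ (fderiv ℝ φ) y x x := by
  have hx : ∑ i, x i • EuclideanSpace.single i (1 : ℝ) = x := by
    simpa using (EuclideanSpace.basisFun (Fin n) ℝ).sum_repr x
  conv_rhs => rw [← hx]
  simp only [map_sum, map_smul, sum_apply, smul_apply, smul_eq_mul, dotProduct, Matrix.mulVec,
    hessian, Matrix.of_apply, Finset.mul_sum]
  rw [Finset.sum_comm]
  exact Finset.sum_congr rfl fun i _ => Finset.sum_congr rfl fun j _ => by ring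

theorem posDef_hessian_sub_hessian {n : ℕ} {φ ψ : EuclideanSpace ℝ (Fin n) → ℝ}
    {y y' : EuclideanSpace ℝ (Fin n)} (hφ : ContDiffAt ℝ 2 φ y) (hψ : ContDiffAt ℝ 2 ψ y')
    (h : ∀ x ≠ 0, fderiv ℝ (fderiv ℝ φ) y x x < fderiv ℝ (fderiv ℝ ψ) y' x x) :
    (hessian ψ y' - hessian φ y).PosDef := by
  refine .of_dotProduct_mulVec_pos ((hessian_isHermitian hψ).sub (hessian_isHermitian hφ))
    fun x hx => ?_
  have hlt := h (WithLp.toLp 2 x) ((WithLp.toLp_eq_zero 2).not.2 hx)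
  rw [← dotProduct_hessian_mulVec, ← dotProduct_hessian_mulVec] at hlt
  rw [star_trivial, Matrix.sub_mulVec, dotProduct_sub]
  exact sub_pos.2 hlt

section Density

variable {E F : Type*} [NormedAddCommGroup E] [NormedSpace ℝ E] [FiniteDimensional ℝ E]
  [MeasurableSpace E] [BorelSpace E] {μ : Measure E} [μ.IsAddHaarMeasure]
  [NormedAddCommGroup F] [NormedSpace ℝ F]

theorem isLittleO_infDist_of_density_one {K : Set E} {x : E} (hxK : x ∈ K)
    (hx : Tendsto (fun r => μ (K ∩ closedBall x r) / μ (closedBall x r)) (𝓝[>] 0) (𝓝 1)) :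
    (fun y => infDist y K) =o[𝓝 x] fun y => y - x := by
  refine Asymptotics.IsLittleO.of_bound fun ε hε => ?_
  have hε2 : 0 < ε / 2 := half_pos hε
  obtain ⟨t, -, htfin, hcover⟩ :=
    (isCompact_sphere (0 : E) 1).elim_finite_subcover_image (b := univ)
      (c := fun z => ball z (ε / 2)) (fun _ _ => isOpen_ball)
      fun z _ => mem_biUnion (mem_univ z) (mem_ball_self hε2)
  have hnear : ∀ᶠ r in 𝓝[>] (0 : ℝ), ∀ z ∈ t, (K ∩ ({x} + r • closedBall z (ε / 2))).Nonempty :=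
    htfin.eventually_all.2 fun z _ =>
      Measure.eventually_nonempty_inter_smul_of_density_one μ K x hx _ measurableSet_closedBall
        (measure_closedBall_pos μ z hε2).ne'
  have hnorm : Tendsto (fun y => ‖y - x‖) (𝓝[≠] x) (𝓝[>] 0) := tendsto_norm_sub_self_nhdsNE x
  have hpunct : ∀ᶠ y in 𝓝[≠] x, ‖infDist y K‖ ≤ ε * ‖y - x‖ := by
    filter_upwards [hnorm.eventually hnear, self_mem_nhdsWithin] with y hy hyx
    have hr : 0 < ‖y - x‖ := norm_sub_pos_iff.2 hyx
    set r := ‖y - x‖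
    obtain ⟨z, hz, hzy⟩ := mem_iUnion₂.1 (hcover (show r⁻¹ • (y - x) ∈ sphere 0 1 by
      simp [norm_smul, r, hr.ne']))
    obtain ⟨_, hK, x', hx', _, ⟨w, hw, rfl⟩, rfl⟩ := hy z hz
    obtain rfl : x = x' := hx'.symm
    have hy_eq : y = x + r • r⁻¹ • (y - x) := by rw [smul_inv_smul₀ hr.ne']; abel
    calc ‖infDist y K‖ = infDist y K := Real.norm_of_nonneg infDist_nonneg
      _ ≤ dist y (x + r • w) := infDist_le_dist_of_mem hK
      _ = r * dist (r⁻¹ • (y - x)) w := by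
        nth_rewrite 1 [hy_eq]
        rw [dist_add_left, dist_smul₀, Real.norm_of_nonneg hr.le]
      _ ≤ r * (ε / 2 + ε / 2) := by
        gcongr
        exact (dist_triangle_right _ _ z).trans (add_le_add (mem_ball.1 hzy).le hw)
      _ = ε * r := by ring
  rw [← nhdsNE_sup_pure, eventually_sup]
  exact ⟨hpunct, by simp [infDist_zero_of_mem hxK]⟩

theorem hasFDerivAt_of_hasFDerivWithinAt_of_density_one {K : Set E} {S : E → F} {C : ℝ}
    (hC : ∀ x ∈ K, ∀ y, dist (S y) (S x) ≤ C * dist y x) {x : E} (hxK : x ∈ K) {A : E →L[ℝ] F}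
    (hA : HasFDerivWithinAt S A K x)
    (hx : Tendsto (fun r => μ (K ∩ closedBall x r) / μ (closedBall x r)) (𝓝[>] 0) (𝓝 1)) :
    HasFDerivAt S A x := by
  -- Compare `S y` with `S (π y)`, where `π y` is an almost nearest point of `K`.
  have hnear : ∀ y, ∃ z ∈ K, dist z y ≤ infDist y K + ‖y - x‖ ^ 2 := fun y => by
    obtain hyx | hyx := eq_or_ne y x
    · exact ⟨x, hxK, by simp [hyx, infDist_nonneg]⟩
    · have hpos : 0 < ‖y - x‖ := norm_sub_pos_iff.2 hyx
      obtain ⟨z, hz, hzy⟩ := (infDist_lt_iff ⟨x, hxK⟩).1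
        (lt_add_of_pos_right (infDist y K) (pow_pos hpos 2))
      exact ⟨z, hz, by rw [dist_comm]; exact hzy.le⟩
  choose π hπK hπ using hnear
  have hπ_o : (fun y => π y - y) =o[𝓝 x] fun y => y - x :=
    (Asymptotics.IsBigO.of_norm_le fun y => by rw [← dist_eq_norm]; exact hπ y).trans_isLittleO
      ((isLittleO_infDist_of_density_one hxK hx).add
        (Asymptotics.isLittleO_pow_sub_sub x one_lt_two))
  have hπ_O : (fun y => π y - x) =O[𝓝 x] fun y => y - x := by
    simpa using hπ_o.isBigO.add (Asymptotics.isBigO_refl (fun y => y - x) (𝓝 x))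
  have hπ_tendsto : Tendsto π (𝓝 x) (𝓝[K] x) := by
    refine tendsto_nhdsWithin_iff.2 ⟨?_, .of_forall hπK⟩
    exact tendsto_sub_nhds_zero_iff.1
      (hπ_O.trans_tendsto (tendsto_sub_nhds_zero_iff.2 tendsto_id))
  have hS : (fun y => S (π y) - S y) =o[𝓝 x] fun y => y - x := by
    refine (Asymptotics.IsBigO.of_bound C (.of_forall fun y => ?_)).trans_isLittleO hπ_o
    rw [← dist_eq_norm, ← dist_eq_norm, dist_comm, dist_comm (π y)]
    exact hC _ (hπK y) y
  have hlin : (fun y => A (π y - y)) =o[𝓝 x] fun y => y - x :=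
    (A.isBigO_comp _ _).trans_isLittleO hπ_o
  have hwithin : (fun y => S (π y) - S x - A (π y - x)) =o[𝓝 x] fun y => y - x :=
    ((hasFDerivWithinAt_iff_isLittleO.1 hA).comp_tendsto hπ_tendsto).trans_isBigO hπ_O
  refine hasFDerivAt_iff_isLittleO.2 (((hwithin.sub hS).add hlin).congr_left fun y => ?_)
  simp only [map_sub]
  abel

theorem ae_differentiableAt_of_forall_dist_le [FiniteDimensional ℝ F] {K : Set E} {S : E → F}
    {C : ℝ} (hC : ∀ x ∈ K, ∀ y, dist (S y) (S x) ≤ C * dist y x) :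
    ∀ᵐ x ∂μ, x ∈ K → DifferentiableAt ℝ S x := by
  have hS : LipschitzOnWith C.toNNReal S K := .of_dist_le' fun y _ x hx => hC x hx y
  filter_upwards [hS.ae_differentiableWithinAt_of_mem (μ := μ),
    ae_imp_of_ae_restrict (Besicovitch.ae_tendsto_measure_inter_div μ K)] with x hdiff hdens hx
  exact (hasFDerivAt_of_hasFDerivWithinAt_of_density_one hC hx (hdiff hx).hasFDerivWithinAt
    (hdens hx)).differentiableAt

end Density

theorem exists_mem_differentiableAt_of_subset_image {E F : Type*} [NormedAddCommGroup E]
    [NormedSpace ℝ E] [FiniteDimensional ℝ E] [NormedAddCommGroup F] [NormedSpace ℝ F]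
    [FiniteDimensional ℝ F] {K U : Set E} {S : E → F} {C : ℝ}
    (hC : ∀ x ∈ K, ∀ y, dist (S y) (S x) ≤ C * dist y x) {P : E → E} {L : NNReal}
    (hP : LipschitzOnWith L P K) (hU : IsOpen U) (hne : U.Nonempty) (hUK : U ⊆ P '' K) :
    ∃ x ∈ K, P x ∈ U ∧ DifferentiableAt ℝ S x := by
  borelize E
  set μ : Measure E := Measure.hausdorffMeasure (finrank ℝ E)
  set N : Set E := {x ∈ K | ¬ DifferentiableAt ℝ S x}
  have hN : μ N = 0 := by
    simpa [ae_iff, N] using ae_differentiableAt_of_forall_dist_le (μ := μ) hC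
  have hPN : μ (P '' N) = 0 := by
    refine nonpos_iff_eq_zero.1 (((hP.mono (sep_subset K _)).hausdorffMeasure_image_le
      (Nat.cast_nonneg (finrank ℝ E))).trans_eq ?_)
    rw [hN, mul_zero]
  obtain ⟨p, hpU, hpN⟩ : (U \ P '' N).Nonempty :=
    nonempty_of_measure_ne_zero (μ := μ) (by
      rw [measure_sdiff_null hPN]
      exact (hU.measure_pos μ hne).ne')
  obtain ⟨x, hx, rfl⟩ := hUK hpU
  exact ⟨x, hx, hpU, by_contra fun hd => hpN ⟨x, ⟨hx, hd⟩, rfl⟩⟩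

theorem sub_le_of_sub_le_mul_add_mul_sq {ψ : ℝ → ℝ} {κ M : ℝ}
    (h : ∀ s ∈ Icc (0 : ℝ) 1, ∀ t ∈ Icc (0 : ℝ) 1, s ≤ t →
      ψ t - ψ s ≤ (t - s) * κ + M * (t - s) ^ 2) : ψ 1 - ψ 0 ≤ κ := by
  have hpartition (N : ℕ) : ψ 1 - ψ 0 ≤ κ + M / ((N : ℝ) + 1) := by
    have hN : (0 : ℝ) < N + 1 := by positivity
    have hIcc (j : ℕ) (hj : j ≤ N + 1) : (j : ℝ) / (N + 1) ∈ Icc (0 : ℝ) 1 :=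
      ⟨by positivity, (div_le_one hN).2 (mod_cast hj)⟩
    calc ψ 1 - ψ 0
        = ∑ j ∈ Finset.range (N + 1), (ψ ((j + 1 : ℕ) / (N + 1)) - ψ (j / (N + 1))) := by
          rw [Finset.sum_range_sub fun j : ℕ => ψ (j / (N + 1))]
          simp [div_self hN.ne']
      _ ≤ ∑ _j ∈ Finset.range (N + 1), (1 / ((N : ℝ) + 1) * κ + M * (1 / (N + 1)) ^ 2) := by
          refine Finset.sum_le_sum fun j hj => ?_
          have hj : j < N + 1 := Finset.mem_range.1 hj
          refine (h _ (hIcc j hj.le) _ (hIcc (j + 1) hj) (by gcongr; simp)).trans_eq ?_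
          rw [← sub_div]
          simp
      _ = κ + M / (N + 1) := by
          simp only [Finset.sum_const, Finset.card_range, nsmul_eq_mul, Nat.cast_add, Nat.cast_one]
          field_simp
  have hlim : Tendsto (fun N : ℕ => κ + M / ((N : ℝ) + 1)) atTop (𝓝 (κ + 0)) :=
    ((tendsto_add_atTop_iff_nat (f := fun N : ℕ => M / (N : ℝ)) 1).2
      (tendsto_const_div_atTop_nhds_zero_nat M) |>.congr fun N => by simp).const_add κ
  rw [add_zero] at hlim
  exact ge_of_tendsto' hlim hpartition

section Semiconvex

variable {E : Type*} [NormedAddCommGroup E] [InnerProductSpace ℝ E]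

/-- `S` selects proximal subgradients of `F` with constant `c`. Such a selection exists precisely
when `F + c‖·‖²` is convex and everywhere subdifferentiable, so this is a first order way of
saying that `F` is semiconvex. -/
def IsProximalSelection (c : ℝ) (F : E → ℝ) (S : E → E) : Prop :=
  ∀ x y, F x + ⟪S x, y - x⟫ - c * ‖y - x‖ ^ 2 ≤ F y

variable {F : E → ℝ} {S : E → E} {c : ℝ}

theorem IsProximalSelection.taylor_remainder_sub_le (hF : IsProximalSelection c F S)
    (A : E →L[ℝ] E) (x h : E) (s t : ℝ) :
    (F (x + t • h) - t * ⟪S x, h⟫ - t ^ 2 * (⟪A h, h⟫ / 2)) -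
        (F (x + s • h) - s * ⟪S x, h⟫ - s ^ 2 * (⟪A h, h⟫ / 2)) ≤
      (t - s) * ⟪S (x + t • h) - S x - A (t • h), h⟫ +
        (c * ‖h‖ ^ 2 + ⟪A h, h⟫ / 2) * (t - s) ^ 2 := by
  have hsub := hF (x + t • h) (x + s • h)
  rw [add_sub_add_left_eq_sub, ← sub_smul, norm_smul, mul_pow, Real.norm_eq_abs, sq_abs,
    real_inner_smul_right] at hsub
  rw [inner_sub_left, inner_sub_left, map_smul, real_inner_smul_left]
  linarith

theorem IsProximalSelection.isLittleO_taylor_two (hF : IsProximalSelection c F S)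
    {A : E →L[ℝ] E} {x : E} (hA : HasFDerivAt S A x) :
    (fun h => F (x + h) - F x - ⟪S x, h⟫ - ⟪A h, h⟫ / 2) =o[𝓝 0] fun h => ‖h‖ ^ 2 := by
  refine Asymptotics.IsLittleO.of_bound fun σ hσ => ?_
  obtain ⟨r, hr, hball⟩ := Metric.eventually_nhds_iff_ball.1
    ((hasFDerivAt_iff_isLittleO_nhds_zero.1 hA).bound hσ)
  filter_upwards [ball_mem_nhds (0 : E) hr] with h hh
  have hremainder (t : ℝ) (ht : t ∈ Icc (0 : ℝ) 1) :
      |⟪S (x + t • h) - S x - A (t • h), h⟫| ≤ σ * ‖h‖ ^ 2 := by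
    have hth : ‖t • h‖ ≤ ‖h‖ := by
      rw [norm_smul, Real.norm_of_nonneg ht.1]
      exact mul_le_of_le_one_left (norm_nonneg h) ht.2
    calc |⟪S (x + t • h) - S x - A (t • h), h⟫|
        ≤ ‖S (x + t • h) - S x - A (t • h)‖ * ‖h‖ := abs_real_inner_le_norm _ _
      _ ≤ σ * ‖h‖ * ‖h‖ := by
        gcongr
        refine (hball _ ?_).trans (by gcongr)
        exact mem_ball_zero_iff.2 (hth.trans_lt (mem_ball_zero_iff.1 hh))
      _ = σ * ‖h‖ ^ 2 := by ring
  set R : ℝ → ℝ := fun t => F (x + t • h) - t * ⟪S x, h⟫ - t ^ 2 * (⟪A h, h⟫ / 2)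
  have hupper : R 1 - R 0 ≤ σ * ‖h‖ ^ 2 :=
    sub_le_of_sub_le_mul_add_mul_sq fun s _ t ht hst =>
      (hF.taylor_remainder_sub_le A x h s t).trans <| add_le_add_left
        (mul_le_mul_of_nonneg_left (abs_le.1 (hremainder t ht)).2 (sub_nonneg.2 hst)) _
  have hlower : -R 1 - -R 0 ≤ σ * ‖h‖ ^ 2 :=
    sub_le_of_sub_le_mul_add_mul_sq (ψ := fun t => -R t) (M := c * ‖h‖ ^ 2 + ⟪A h, h⟫ / 2)
      fun s hs t _ hst => by
      have hle : R s - R t ≤ _ := hF.taylor_remainder_sub_le A x h t s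
      have hmul := mul_le_mul_of_nonneg_left (neg_le.1 (abs_le.1 (hremainder s hs)).1)
        (sub_nonneg.2 hst)
      linarith
  have hR : F (x + h) - F x - ⟪S x, h⟫ - ⟪A h, h⟫ / 2 = R 1 - R 0 := by
    simp only [R, one_smul, zero_smul, add_zero]
    ring
  rw [hR, Real.norm_eq_abs, Real.norm_of_nonneg (sq_nonneg _), abs_le]
  constructor <;> linarith

/-- `p` is a supergradient of `H` at `x`, in the sense of concave analysis. -/
def IsSupergradient (H : E → ℝ) (x p : E) : Prop :=
  ∀ y, H y ≤ H x + ⟪p, y - x⟫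

theorem norm_le_of_forall_inner_le {D a : E} (hc : 0 < c)
    (h : ∀ e, ⟪D, e⟫ ≤ c * (‖a + e‖ ^ 2 + ‖e‖ ^ 2 + ‖a‖ ^ 2)) : ‖D‖ ≤ 6 * c * ‖a‖ := by
  set d := (6 * c)⁻¹ * ‖D‖
  have hD : ‖D‖ = 6 * c * d := (mul_inv_cancel_left₀ (by positivity) _).symm
  have he : ‖(6 * c)⁻¹ • D‖ = d := by rw [norm_smul, Real.norm_of_nonneg (by positivity)]
  have hae : ‖a + (6 * c)⁻¹ • D‖ ≤ ‖a‖ + d := he ▸ norm_add_le a _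
  have hsq : ⟪D, (6 * c)⁻¹ • D⟫ = 6 * c * d ^ 2 := by
    rw [real_inner_smul_right, real_inner_self_eq_norm_sq]
    linear_combination d * hD
  have hbound : c * (6 * d ^ 2) ≤ c * ((‖a‖ + d) ^ 2 + d ^ 2 + ‖a‖ ^ 2) := by
    have := h ((6 * c)⁻¹ • D)
    rw [hsq, he] at this
    calc c * (6 * d ^ 2) = 6 * c * d ^ 2 := by ring
      _ ≤ _ := this
      _ ≤ _ := by gcongr
  have hda : d ≤ ‖a‖ := by
    have := le_of_mul_le_mul_left hbound hc
    nlinarith [norm_nonneg a, show 0 ≤ d by positivity]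
  rw [hD]
  gcongr

theorem IsProximalSelection.dist_le_of_touches_above (hc : 0 < c) (hF : IsProximalSelection c F S)
    {x : E} (hx : ∀ z, F z ≤ F x + ⟪S x, z - x⟫ + c * ‖z - x‖ ^ 2) (y : E) :
    dist (S y) (S x) ≤ 6 * c * dist y x := by
  rw [dist_eq_norm, dist_eq_norm]
  refine norm_le_of_forall_inner_le hc fun e => ?_
  have hyz := hF y (y + e)
  have hxy := hF x y
  have hxz := hx (y + e)
  have hsplit : y + e - x = y - x + e := by abel
  rw [add_sub_cancel_left] at hyz
  rw [hsplit, inner_add_right] at hxz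
  rw [inner_sub_left]
  linarith

variable {G : E → ℝ} {T : E → E} {x p : E}

theorem IsSupergradient.add_eq (hc : 0 < c) (hF : IsProximalSelection c F S)
    (hG : IsProximalSelection c G T) (hx : IsSupergradient (F + G) x p) : S x + T x = p := by
  have hnorm : ‖S x + T x - p‖ ≤ 6 * c * ‖(0 : E)‖ := norm_le_of_forall_inner_le hc fun e => by
    have hFe := hF x (x + e)
    have hGe := hG x (x + e)
    have hxe := hx (x + e)
    simp only [Pi.add_apply, add_sub_cancel_left] at hFe hGe hxe
    rw [inner_sub_left, inner_add_left, zero_add, norm_zero]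
    linarith
  rwa [norm_zero, mul_zero, norm_le_zero_iff, sub_eq_zero] at hnorm

theorem IsSupergradient.touches_above (hc : 0 < c) (hF : IsProximalSelection c F S)
    (hG : IsProximalSelection c G T) (hx : IsSupergradient (F + G) x p) (z : E) :
    F z ≤ F x + ⟪S x, z - x⟫ + c * ‖z - x‖ ^ 2 := by
  have hGz := hG x z
  have hxz := hx z
  rw [← hx.add_eq hc hF hG, inner_add_left] at hxz
  simp only [Pi.add_apply] at hxz
  linarith

theorem IsSupergradient.inner_add_inner_nonpos (hc : 0 < c) (hF : IsProximalSelection c F S)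
    (hG : IsProximalSelection c G T) (hx : IsSupergradient (F + G) x p) {A B : E →L[ℝ] E}
    (hA : HasFDerivAt S A x) (hB : HasFDerivAt T B x) (h : E) : ⟪A h, h⟫ + ⟪B h, h⟫ ≤ 0 := by
  have hray : Tendsto (fun t : ℝ => t • h) (𝓝[>] 0) (𝓝 0) :=
    (Continuous.tendsto' (by fun_prop) 0 _ (zero_smul ℝ h)).mono_left nhdsWithin_le_nhds
  have hexpand := (hF.isLittleO_taylor_two hA).add (hG.isLittleO_taylor_two hB)
  refine le_of_forall_pos_le_add fun ε hε => ?_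
  have hσ : 0 < ε / (2 * (‖h‖ ^ 2 + 1)) := by positivity
  obtain ⟨t, hle, ht⟩ :=
    ((hray.eventually (hexpand.bound hσ)).and self_mem_nhdsWithin).exists
  have ht0 : 0 < t := ht
  have hxt := hx (x + t • h)
  rw [← hx.add_eq hc hF hG, add_sub_cancel_left, inner_add_left] at hxt
  simp only [Pi.add_apply] at hxt
  rw [Real.norm_of_nonneg (sq_nonneg ‖t • h‖)] at hle
  have hlower := (abs_le.1 hle).1
  simp only [map_smul, real_inner_smul_left, real_inner_smul_right, norm_smul,
    Real.norm_of_nonneg ht0.le, mul_pow] at hlower hxt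
  have hε' : ε / (2 * (‖h‖ ^ 2 + 1)) * ‖h‖ ^ 2 ≤ ε / 2 := by
    rw [div_mul_eq_mul_div, div_le_div_iff₀ (by positivity) two_pos]
    nlinarith [sq_nonneg ‖h‖]
  have : t ^ 2 * (⟪A h, h⟫ + ⟪B h, h⟫) ≤ t ^ 2 * (0 + ε) := by
    have := mul_le_mul_of_nonneg_left hε' (sq_nonneg t)
    linarith
  exact le_of_mul_le_mul_left this (by positivity)

/-- **Jensen's lemma**. The selections are Lipschitz at the points where `F + G` has a
supergradient, and the Lipschitz map `S + T` sends these points onto a superset of `U`; since it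
preserves null sets, `S` and `T` must be differentiable at one of them. -/
theorem exists_isSupergradient_differentiableAt [FiniteDimensional ℝ E] (hc : 0 < c)
    (hF : IsProximalSelection c F S) (hG : IsProximalSelection c G T) {U : Set E} (hU : IsOpen U)
    (hne : U.Nonempty) (hUx : ∀ p ∈ U, ∃ x, IsSupergradient (F + G) x p) :
    ∃ p ∈ U, ∃ x, IsSupergradient (F + G) x p ∧ DifferentiableAt ℝ S x ∧
      DifferentiableAt ℝ T x := by
  set K : Set E := {x | IsSupergradient (F + G) x (S x + T x)}
  have hS (x) (hx : x ∈ K) (y) : dist (S y) (S x) ≤ 6 * c * dist y x :=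
    hF.dist_le_of_touches_above hc (IsSupergradient.touches_above hc hF hG hx) y
  have hT (x) (hx : x ∈ K) (y) : dist (T y) (T x) ≤ 6 * c * dist y x := by
    have hx' : IsSupergradient (G + F) x (S x + T x) := by rw [add_comm G F]; exact hx
    exact hG.dist_le_of_touches_above hc (hx'.touches_above hc hG hF) y
  have hP : LipschitzOnWith (Real.toNNReal (6 * c) + Real.toNNReal (6 * c)) (S + T) K :=
    LipschitzOnWith.add (.of_dist_le' fun y _ x hx => hS x hx y)
      (.of_dist_le' fun y _ x hx => hT x hx y)
  have hUK : U ⊆ (S + T) '' K := fun p hp => by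
    obtain ⟨x, hx⟩ := hUx p hp
    have hST := hx.add_eq hc hF hG
    exact ⟨x, by rwa [← hST] at hx, hST⟩
  obtain ⟨x, hxK, hxU, hd⟩ := exists_mem_differentiableAt_of_subset_image
    (S := fun x => (S x, T x)) (fun x hx y => max_le (hS x hx y) (hT x hx y)) hP hU hne hUK
  exact ⟨_, hxU, x, hxK, hd.fst, hd.snd⟩

end Semiconvex

section Superjet

variable {E : Type*} [NormedAddCommGroup E] [InnerProductSpace ℝ E]

/-- `(ℓ, A)` belongs to the second order superjet `J^{2,+} u(x)`. Here `A` need not be symmetric: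
only its quadratic form matters. -/
def IsSuperjet (u : E → ℝ) (x ℓ : E) (A : E →L[ℝ] E) : Prop :=
  ∀ σ > 0, ∀ᶠ w in 𝓝 0, u (x + w) ≤ u x + ⟪ℓ, w⟫ + ⟪A w, w⟫ / 2 + σ * ‖w‖ ^ 2

theorem IsSuperjet.of_add_norm_sq {u : E → ℝ} {x ℓ : E} {A : E →L[ℝ] E} {η : ℝ}
    (h : IsSuperjet (fun z => u z + η / 2 * ‖z‖ ^ 2) x ℓ A) :
    IsSuperjet u x (ℓ - η • x) (A - η • ContinuousLinearMap.id ℝ E) := fun σ hσ => by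
  filter_upwards [h σ hσ] with w hw
  rw [norm_add_sq_real] at hw
  simp only [inner_sub_left, real_inner_smul_left, sub_apply, smul_apply,
    ContinuousLinearMap.id_apply, real_inner_self_eq_norm_sq]
  linarith

/-- The quadratic polynomial centred at `y` with gradient `ℓ` and Hessian form `⟪L ·, ·⟫`. -/
noncomputable def paraboloid (y ℓ : E) (L : E →L[ℝ] E) (z : E) : ℝ :=
  ⟪ℓ, z - y⟫ + ⟪L (z - y), z - y⟫ / 2

theorem contDiff_paraboloid (y ℓ : E) (L : E →L[ℝ] E) : ContDiff ℝ 2 (paraboloid y ℓ L) := by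
  have hsub : ContDiff ℝ 2 fun z : E => z - y := contDiff_id.sub contDiff_const
  exact (contDiff_const.inner ℝ hsub).add (((L.contDiff.comp hsub).inner ℝ hsub).div_const 2)

theorem hasFDerivAt_paraboloid (y ℓ : E) (L : E →L[ℝ] E) (z : E) :
    HasFDerivAt (paraboloid y ℓ L) (innerSL ℝ ℓ + (2⁻¹ : ℝ) •
      (innerSL ℝ (L (z - y)) + innerSL ℝ (z - y) ∘L L)) z := by
  have hsub : HasFDerivAt (fun z : E => z - y) (.id ℝ E) z := (hasFDerivAt_id z).sub_const y
  have hderiv := ((hasFDerivAt_const ℓ z).inner ℝ hsub).add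
    (((L.hasFDerivAt.comp z hsub).inner ℝ hsub).mul_const (2⁻¹ : ℝ))
  refine (hderiv.congr_fderiv ?_).congr_of_eventuallyEq (.of_forall fun z => ?_)
  · ext h
    simp [inner_sub_left, inner_sub_right, real_inner_comm, mul_add]
  · simp [paraboloid, div_eq_mul_inv]

theorem fderiv_fderiv_paraboloid (y ℓ : E) (L : E →L[ℝ] E) (h : E) :
    fderiv ℝ (fderiv ℝ (paraboloid y ℓ L)) y h h = ⟪L h, h⟫ := by
  set Q : E →L[ℝ] E →L[ℝ] ℝ := (innerSL ℝ).comp L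
  have hfderiv : fderiv ℝ (paraboloid y ℓ L) =
      fun z => innerSL ℝ ℓ + ((2⁻¹ : ℝ) • (Q + Q.flip)) (z - y) := funext fun z => by
    rw [(hasFDerivAt_paraboloid y ℓ L z).fderiv]
    ext h
    simp [Q, real_inner_comm]
  have hlin : HasFDerivAt (fun z => innerSL ℝ ℓ + ((2⁻¹ : ℝ) • (Q + Q.flip)) (z - y))
      ((2⁻¹ : ℝ) • (Q + Q.flip)) y :=
    (((2⁻¹ : ℝ) • (Q + Q.flip)).hasFDerivAt.comp y ((hasFDerivAt_id y).sub_const y)).const_add _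
  rw [hfderiv, hlin.fderiv]
  simp [Q]
  ring

theorem IsSuperjet.exists_isLocalMax {u : E → ℝ} {x ℓ : E} {A : E →L[ℝ] E}
    (h : IsSuperjet u x ℓ A) {σ : ℝ} (hσ : 0 < σ) :
    ∃ φ : E → ℝ, ContDiff ℝ 2 φ ∧ IsLocalMax (fun z => u z - φ z) x ∧
      ∀ e, fderiv ℝ (fderiv ℝ φ) x e e = ⟪A e, e⟫ + 2 * σ * ‖e‖ ^ 2 := by
  refine ⟨paraboloid x ℓ (A + (2 * σ) • .id ℝ E), contDiff_paraboloid _ _ _, ?_, fun e => ?_⟩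
  · have hsub : Tendsto (fun z => z - x) (𝓝 x) (𝓝 0) := tendsto_sub_nhds_zero_iff.2 tendsto_id
    filter_upwards [hsub.eventually (h σ hσ)] with z hz
    simp only [paraboloid, add_sub_cancel, sub_self, inner_zero_right, add_apply, smul_apply,
      ContinuousLinearMap.id_apply, inner_add_left, real_inner_smul_left,
      real_inner_self_eq_norm_sq] at hz ⊢
    linarith
  · rw [fderiv_fderiv_paraboloid]
    simp [inner_add_left, real_inner_smul_left]

end Superjet

section SupConvolution

variable {E : Type*} [NormedAddCommGroup E]

/-- `F x = max_{y ∈ K} (f y - k/2 ‖x - y‖²)` is the sup-convolution of `f` over `K`, and the maximum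
is attained at `y = s x`. -/
structure IsSupConvolution (k : ℝ) (K : Set E) (f F : E → ℝ) (s : E → E) : Prop where
  mem : ∀ x, s x ∈ K
  eq : ∀ x, F x = f (s x) - k / 2 * ‖x - s x‖ ^ 2
  le : ∀ x, ∀ y ∈ K, f y - k / 2 * ‖x - y‖ ^ 2 ≤ F x

theorem exists_isSupConvolution (k : ℝ) {K : Set E} (hK : IsCompact K) (hne : K.Nonempty)
    {f : E → ℝ} (hf : UpperSemicontinuousOn f K) : ∃ F s, IsSupConvolution k K f F s := by
  have hmax (x : E) : ∃ y ∈ K, IsMaxOn (fun y => f y + -(k / 2 * ‖x - y‖ ^ 2)) K y :=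
    (hf.add (Continuous.continuousOn (by fun_prop)).upperSemicontinuousOn).exists_isMaxOn hne hK
  choose s hs hmax using hmax
  exact ⟨_, s, hs, fun _ => rfl, fun x y hy => by
    simpa only [sub_eq_add_neg] using isMaxOn_iff.1 (hmax x) y hy⟩

variable [InnerProductSpace ℝ E]

namespace IsSupConvolution

variable {k : ℝ} {K : Set E} {f g F G : E → ℝ} {s t : E → E}

theorem isProximalSelection (hF : IsSupConvolution k K f F s) :
    IsProximalSelection (k / 2) F fun x => k • (s x - x) := fun x y => by
  refine le_trans (le_of_eq ?_) (hF.le y (s x) (hF.mem x))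
  rw [hF.eq, ← sub_add_sub_cancel y x (s x), norm_add_sq_real, real_inner_smul_left,
    real_inner_comm, ← neg_sub x (s x), inner_neg_right]
  ring

theorem isSuperjet (hF : IsSupConvolution k K f F s) {x : E} {A : E →L[ℝ] E}
    (hA : HasFDerivAt (fun x => k • (s x - x)) A x) (hK : K ∈ 𝓝 (s x)) :
    IsSuperjet f (s x) (k • (s x - x)) A := fun σ hσ => by
  have hmem : ∀ᶠ w in 𝓝 0, s x + w ∈ K :=
    (Continuous.tendsto' (by fun_prop) 0 (s x) (add_zero _)).eventually hK
  filter_upwards [hmem, (hF.isProximalSelection.isLittleO_taylor_two hA).bound hσ] with w hw hexpand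
  have hle := hF.le (x + w) (s x + w) hw
  rw [add_sub_add_right_eq_sub] at hle
  rw [Real.norm_of_nonneg (sq_nonneg ‖w‖)] at hexpand
  have hupper := (abs_le.1 hexpand).2
  rw [hF.eq x] at hupper
  linarith

end IsSupConvolution

/-- The functional obtained by doubling the variables, tilted by the linear form `p`. -/
noncomputable def doubled (k : ℝ) (f g : E → ℝ) (p y y' : E) : ℝ :=
  f y + g y' - k / 4 * ‖y - y'‖ ^ 2 - ⟪p, (2⁻¹ : ℝ) • (y + y')⟫

variable {k : ℝ} {K : Set E} {f g F G : E → ℝ} {s t : E → E}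

theorem sub_norm_sq_sub_norm_sq_sub_inner_eq (hk : 0 < k) (f g : E → ℝ) (p y y' z : E) :
    f y - k / 2 * ‖z - y‖ ^ 2 + (g y' - k / 2 * ‖z - y'‖ ^ 2) - ⟪p, z⟫ =
      doubled k f g p y y' + ‖p‖ ^ 2 / (4 * k) -
        k * ‖z - ((2⁻¹ : ℝ) • (y + y') - (2 * k)⁻¹ • p)‖ ^ 2 := by
  simp only [doubled, ← real_inner_self_eq_norm_sq, inner_sub_left, inner_sub_right, inner_add_left,
    inner_add_right, real_inner_smul_left, real_inner_smul_right, real_inner_comm p z,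
    real_inner_comm p y, real_inner_comm p y', real_inner_comm z y, real_inner_comm z y',
    real_inner_comm y y']
  field_simp
  ring

theorem IsSupConvolution.add_sub_inner_le_doubled (hk : 0 < k) (hF : IsSupConvolution k K f F s)
    (hG : IsSupConvolution k K g G t) (p z : E) :
    F z + G z - ⟪p, z⟫ ≤ doubled k f g p (s z) (t z) + ‖p‖ ^ 2 / (4 * k) := by
  rw [hF.eq, hG.eq, sub_norm_sq_sub_norm_sq_sub_inner_eq hk]
  exact sub_le_self _ (by positivity)

theorem exists_isMaxOn_doubled (k : ℝ) (hK : IsCompact K) (hne : K.Nonempty)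
    (hf : UpperSemicontinuousOn f K) (hg : UpperSemicontinuousOn g K) (p : E) :
    ∃ y ∈ K, ∃ y' ∈ K, ∀ z ∈ K, ∀ z' ∈ K, doubled k f g p z z' ≤ doubled k f g p y y' := by
  have hf' : UpperSemicontinuousOn (fun q : E × E => f q.1) (K ×ˢ K) :=
    hf.comp continuousOn_fst fun _ hq => hq.1
  have hg' : UpperSemicontinuousOn (fun q : E × E => g q.2) (K ×ˢ K) :=
    hg.comp continuousOn_snd fun _ hq => hq.2
  have hcont : Continuous fun q : E × E =>
      -(k / 4 * ‖q.1 - q.2‖ ^ 2) + -⟪p, (2⁻¹ : ℝ) • (q.1 + q.2)⟫ := by fun_prop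
  obtain ⟨⟨y, y'⟩, ⟨hy, hy'⟩, hmax⟩ :=
    ((hf'.add hg').add hcont.continuousOn.upperSemicontinuousOn).exists_isMaxOn (hne.prod hne)
      (hK.prod hK)
  refine ⟨y, hy, y', hy', fun z hz z' hz' => ?_⟩
  simpa only [doubled, sub_eq_add_neg, add_assoc] using
    isMaxOn_iff.1 hmax _ (mk_mem_prod hz hz')

theorem IsSupConvolution.exists_isSupergradient (hk : 0 < k) (hK : IsCompact K) (hne : K.Nonempty)
    (hf : UpperSemicontinuousOn f K) (hg : UpperSemicontinuousOn g K)
    (hF : IsSupConvolution k K f F s) (hG : IsSupConvolution k K g G t) (p : E) :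
    ∃ x, IsSupergradient (F + G) x p := by
  obtain ⟨y, hy, y', hy', hmax⟩ := exists_isMaxOn_doubled k hK hne hf hg p
  refine ⟨(2⁻¹ : ℝ) • (y + y') - (2 * k)⁻¹ • p, fun z => ?_⟩
  set x := (2⁻¹ : ℝ) • (y + y') - (2 * k)⁻¹ • p with hx
  have hle : F z + G z - ⟪p, z⟫ ≤ F x + G x - ⟪p, x⟫ :=
    calc F z + G z - ⟪p, z⟫
        ≤ doubled k f g p (s z) (t z) + ‖p‖ ^ 2 / (4 * k) := hF.add_sub_inner_le_doubled hk hG p z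
      _ ≤ doubled k f g p y y' + ‖p‖ ^ 2 / (4 * k) := by
        gcongr
        exact hmax _ (hF.mem z) _ (hG.mem z)
      _ = f y - k / 2 * ‖x - y‖ ^ 2 + (g y' - k / 2 * ‖x - y'‖ ^ 2) - ⟪p, x⟫ := by
        rw [sub_norm_sq_sub_norm_sq_sub_inner_eq hk, ← hx, sub_self, norm_zero]
        ring
      _ ≤ F x + G x - ⟪p, x⟫ := by
        gcongr
        exacts [hF.le x y hy, hG.le x y' hy']
  rw [Pi.add_apply, Pi.add_apply, inner_sub_right]
  linarith

theorem IsSupergradient.add_le_of_isSupConvolution (hk : 0 < k) (hF : IsSupConvolution k K f F s)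
    (hG : IsSupConvolution k K g G t) {x p : E} (hx : IsSupergradient (F + G) x p) {x₀ : E}
    (hx₀ : x₀ ∈ K) :
    f x₀ + g x₀ - ⟪p, x₀⟫ ≤ doubled k f g p (s x) (t x) + ‖p‖ ^ 2 / (4 * k) := by
  refine le_trans ?_ (hF.add_sub_inner_le_doubled hk hG p x)
  have hle := hx x₀
  have hf₀ := hF.le x₀ x₀ hx₀
  have hg₀ := hG.le x₀ x₀ hx₀
  rw [sub_self, norm_zero, zero_pow two_ne_zero, mul_zero, sub_zero] at hf₀ hg₀
  rw [Pi.add_apply, Pi.add_apply, inner_sub_right] at hle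
  linarith

end SupConvolution

section Penalization

variable {X : Type*} [MetricSpace X] {K Ω : Set X} {f g : X → ℝ} {a : ℝ}

theorem exists_pos_forall_dist_lt_mem (hK : IsCompact K) (hΩ : IsOpen Ω)
    (hf : UpperSemicontinuousOn f K) (hg : UpperSemicontinuousOn g K)
    (hlt : ∀ z ∈ K \ Ω, f z + g z < a) :
    ∃ ρ > 0, ∀ y ∈ K, ∀ y' ∈ K, a ≤ f y + g y' → dist y y' < ρ → y ∈ Ω ∧ y' ∈ Ω := by
  have hf' : UpperSemicontinuousOn (fun q : X × X => f q.1) (K ×ˢ K) :=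
    hf.comp continuousOn_fst fun _ hq => hq.1
  have hg' : UpperSemicontinuousOn (fun q : X × X => g q.2) (K ×ˢ K) :=
    hg.comp continuousOn_snd fun _ hq => hq.2
  have hlevel : IsCompact (K ×ˢ K ∩ (fun q : X × X => f q.1 + g q.2) ⁻¹' Ici a) :=
    (hf'.add hg').isCompact_inter_preimage_Ici (hK.prod hK) a
  have hbad : IsCompact ((K ×ˢ K ∩ (fun q : X × X => f q.1 + g q.2) ⁻¹' Ici a) \ Ω ×ˢ Ω) :=
    hlevel.diff (hΩ.prod hΩ)
  obtain ⟨ρ, hρ, hle⟩ := hbad.exists_forall_le' (f := fun q => dist q.1 q.2) (a := 0)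
    continuous_dist.continuousOn (by
      rintro ⟨y, y'⟩ ⟨⟨⟨hy, -⟩, ha⟩, hout⟩
      refine dist_pos.2 fun heq : y = y' => ?_
      subst heq
      exact (hlt y ⟨hy, fun hyΩ => hout ⟨hyΩ, hyΩ⟩⟩).not_ge ha)
  exact ⟨ρ, hρ, fun y hy y' hy' ha hd => by_contra fun hout =>
    hd.not_ge (hle (y, y') ⟨⟨⟨hy, hy'⟩, ha⟩, hout⟩)⟩

theorem exists_penalization (hK : IsCompact K) (hΩ : IsOpen Ω)
    (hf : UpperSemicontinuousOn f K) (hg : UpperSemicontinuousOn g K)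
    (hlt : ∀ z ∈ K \ Ω, f z + g z < a) :
    ∃ k > 0, ∀ y ∈ K, ∀ y' ∈ K, a ≤ f y + g y' - k * dist y y' ^ 2 → y ∈ Ω ∧ y' ∈ Ω := by
  obtain ⟨ρ, hρ, hmem⟩ := exists_pos_forall_dist_lt_mem hK hΩ hf hg hlt
  obtain ⟨M, hM⟩ := hf.bddAbove_of_isCompact hK
  obtain ⟨M', hM'⟩ := hg.bddAbove_of_isCompact hK
  set k := (|M + M' - a| + 1) / ρ ^ 2
  have hk : 0 < k := by positivity
  refine ⟨k, hk, fun y hy y' hy' ha => hmem y hy y' hy' ?_ ?_⟩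
  · exact ha.trans (sub_le_self _ (by positivity))
  · have hsq : k * dist y y' ^ 2 < k * ρ ^ 2 :=
      calc k * dist y y' ^ 2 ≤ f y + g y' - a := le_sub_comm.1 ha
        _ ≤ M + M' - a := by gcongr; exacts [hM ⟨y, hy, rfl⟩, hM' ⟨y', hy', rfl⟩]
        _ < |M + M' - a| + 1 := (le_abs_self _).trans_lt (lt_add_one _)
        _ = k * ρ ^ 2 := (div_mul_cancel₀ _ (by positivity)).symm
    exact lt_of_pow_lt_pow_left₀ 2 hρ.le (lt_of_mul_lt_mul_left hsq hk.le)

end Penalization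

theorem exists_pos_forall_add_norm_sq_lt {E : Type*} [NormedAddCommGroup E] {K Ω : Set E}
    {w : E → ℝ} (hK : Bornology.IsBounded K) (hw : ∀ z ∈ K \ Ω, w z ≤ 0) {x₀ : E} (hx₀ : 0 < w x₀) :
    ∃ η > 0, ∃ a < w x₀ + η / 2 * ‖x₀‖ ^ 2, ∀ z ∈ K \ Ω, w z + η / 2 * ‖z‖ ^ 2 < a := by
  obtain ⟨R, hR, hKR⟩ := hK.exists_pos_norm_le
  refine ⟨w x₀ / R ^ 2, by positivity, w x₀ * (3 / 4), ?_, fun z hz => ?_⟩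
  · have : 0 ≤ w x₀ / R ^ 2 / 2 * ‖x₀‖ ^ 2 := by positivity
    linarith
  · calc w z + w x₀ / R ^ 2 / 2 * ‖z‖ ^ 2 ≤ 0 + w x₀ / R ^ 2 / 2 * R ^ 2 := by
          gcongr
          exacts [hw z hz, hKR z hz.1]
      _ < w x₀ * (3 / 4) := by
          field_simp
          linarith

section MaximumPrinciple

variable {E : Type*} [NormedAddCommGroup E] [InnerProductSpace ℝ E]

theorem exists_isOpen_forall_le_sub_norm_sq_of_le_doubled {K : Set E}
    (hK : Bornology.IsBounded K) {f g : E → ℝ} {a k : ℝ} {x₀ : E} (hx₀ : x₀ ∈ K)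
    (ha : a < f x₀ + g x₀) :
    ∃ U : Set E, IsOpen U ∧ U.Nonempty ∧ ∀ p ∈ U, ∀ y ∈ K, ∀ y' ∈ K,
      f x₀ + g x₀ - ⟪p, x₀⟫ ≤ doubled k f g p y y' + ‖p‖ ^ 2 / (4 * k) →
        a ≤ f y + g y' - k / 4 * ‖y - y'‖ ^ 2 := by
  obtain ⟨R, hKR⟩ := hK.exists_norm_le
  have hcont : Continuous fun p : E => ‖p‖ * (2 * R) + ‖p‖ ^ 2 / (4 * k) := by fun_prop
  refine ⟨_, hcont.isOpen_preimage _ (isOpen_Iio (a := f x₀ + g x₀ - a)), ⟨0, by simpa using ha⟩,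
    fun p hp y hy y' hy' hle => ?_⟩
  have hmid : ‖(2⁻¹ : ℝ) • (y + y')‖ ≤ R := by
    rw [norm_smul, Real.norm_of_nonneg (by norm_num)]
    linarith [norm_add_le y y', hKR y hy, hKR y' hy']
  have hinner : ⟪p, x₀ - (2⁻¹ : ℝ) • (y + y')⟫ ≤ ‖p‖ * (2 * R) := by
    refine (real_inner_le_norm _ _).trans ?_
    gcongr
    linarith [norm_sub_le x₀ ((2⁻¹ : ℝ) • (y + y')), hKR x₀ hx₀]
  have hsmall : ‖p‖ * (2 * R) + ‖p‖ ^ 2 / (4 * k) < f x₀ + g x₀ - a := hp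
  rw [doubled] at hle
  rw [inner_sub_right] at hinner
  linarith

variable [FiniteDimensional ℝ E] {K Ω : Set E}

theorem exists_isSuperjet_inner_add_inner_nonpos {f g : E → ℝ} {a : ℝ} (hK : IsCompact K)
    (hΩ : IsOpen Ω) (hΩK : Ω ⊆ K) (hf : UpperSemicontinuousOn f K)
    (hg : UpperSemicontinuousOn g K) (hlt : ∀ z ∈ K \ Ω, f z + g z < a) {x₀ : E} (hx₀ : x₀ ∈ K)
    (ha : a < f x₀ + g x₀) :
    ∃ y ∈ Ω, ∃ y' ∈ Ω, ∃ ℓ ℓ' : E, ∃ A B : E →L[ℝ] E, IsSuperjet f y ℓ A ∧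
      IsSuperjet g y' ℓ' B ∧ ∀ h, ⟪A h, h⟫ + ⟪B h, h⟫ ≤ 0 := by
  obtain ⟨κ, hκ, hpen⟩ := exists_penalization hK hΩ hf hg hlt
  set k := 4 * κ
  have hk : 0 < k := by positivity
  have hk2 : 0 < k / 2 := half_pos hk
  have hne : K.Nonempty := ⟨x₀, hx₀⟩
  obtain ⟨F, s, hF⟩ := exists_isSupConvolution k hK hne hf
  obtain ⟨G, t, hG⟩ := exists_isSupConvolution k hK hne hg
  obtain ⟨U, hU, hUne, hUle⟩ :=
    exists_isOpen_forall_le_sub_norm_sq_of_le_doubled (k := k) hK.isBounded hx₀ ha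
  obtain ⟨p, hp, x, hx, hS, hT⟩ := exists_isSupergradient_differentiableAt hk2
    hF.isProximalSelection hG.isProximalSelection hU hUne fun p _ =>
      hF.exists_isSupergradient hk hK hne hf hg hG p
  have hval := hUle p hp _ (hF.mem x) _ (hG.mem x) (hx.add_le_of_isSupConvolution hk hF hG hx₀)
  obtain ⟨hsx, htx⟩ := hpen _ (hF.mem x) _ (hG.mem x) (by
    rwa [dist_eq_norm, ← mul_div_cancel_left₀ κ (four_ne_zero' ℝ)])
  exact ⟨s x, hsx, t x, htx, _, _, _, _,
    hF.isSuperjet hS.hasFDerivAt (mem_of_superset (hΩ.mem_nhds hsx) hΩK),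
    hG.isSuperjet hT.hasFDerivAt (mem_of_superset (hΩ.mem_nhds htx) hΩK),
    hx.inner_add_inner_nonpos hk2 hF.isProximalSelection hG.isProximalSelection hS.hasFDerivAt
      hT.hasFDerivAt⟩

theorem exists_test_functions_of_lt {u v : E → ℝ} (hK : IsCompact K) (hΩ : IsOpen Ω) (hΩK : Ω ⊆ K)
    (hu : UpperSemicontinuousOn u K) (hv : LowerSemicontinuousOn v K)
    (hle : ∀ z ∈ K \ Ω, u z ≤ v z) {x₀ : E} (hx₀ : x₀ ∈ K) (hlt : v x₀ < u x₀) :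
    ∃ y ∈ Ω, ∃ y' ∈ Ω, ∃ φ ψ : E → ℝ, ContDiff ℝ 2 φ ∧ ContDiff ℝ 2 ψ ∧
      IsLocalMax (fun z => u z - φ z) y ∧ IsLocalMin (fun z => v z - ψ z) y' ∧
      ∀ h ≠ 0, fderiv ℝ (fderiv ℝ φ) y h h < fderiv ℝ (fderiv ℝ ψ) y' h h := by
  obtain ⟨η, hη, a, ha, hηa⟩ := exists_pos_forall_add_norm_sq_lt (w := fun z => u z - v z)
    hK.isBounded (fun z hz => sub_nonpos.2 (hle z hz)) (sub_pos.2 hlt)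
  have hf : UpperSemicontinuousOn (fun z => u z + η / 2 * ‖z‖ ^ 2) K :=
    hu.add (Continuous.continuousOn (by fun_prop)).upperSemicontinuousOn
  obtain ⟨y, hy, y', hy', ℓ, ℓ', A, B, hA, hB, hAB⟩ := exists_isSuperjet_inner_add_inner_nonpos
    hK hΩ hΩK hf (upperSemicontinuousOn_neg_iff.2 hv) (a := a)
    (fun z hz => by rw [Pi.neg_apply]; linarith [hηa z hz]) hx₀ (by rw [Pi.neg_apply]; linarith)
  have hσ : 0 < η / 8 := by positivity
  obtain ⟨φ, hφ, hmax, hD2φ⟩ := hA.of_add_norm_sq.exists_isLocalMax hσ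
  obtain ⟨ψ, hψ, hmax', hD2ψ⟩ := hB.exists_isLocalMax hσ
  refine ⟨y, hy, y', hy', φ, fun z => -ψ z, hφ, hψ.neg, hmax, ?_, fun h hh => ?_⟩
  · simpa [sub_eq_add_neg, add_comm] using hmax'.neg
  · have hpos : 0 < η * ‖h‖ ^ 2 := by positivity
    have hneg : fderiv ℝ (fderiv ℝ fun z => -ψ z) y' h h = -fderiv ℝ (fderiv ℝ ψ) y' h h := by
      rw [show (fderiv ℝ fun z => -ψ z) = -fderiv ℝ ψ from funext fun z => fderiv_fun_neg,
        fderiv_neg, neg_apply, neg_apply]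
    rw [hneg, hD2φ, hD2ψ]
    simp only [sub_apply, smul_apply, ContinuousLinearMap.id_apply, inner_sub_left,
      real_inner_smul_left, real_inner_self_eq_norm_sq]
    linarith [hAB h]

end MaximumPrinciple

end SpecialLagrangian

theorem theorem6p1 {n : ℕ} (hn : 0 < n) (c : ℝ)
    (Ω : Set (EuclideanSpace ℝ (Fin n))) (hΩ : IsOpen Ω) (hΩb : Bornology.IsBounded Ω)
    (u v : EuclideanSpace ℝ (Fin n) → ℝ)
    (hu : UpperSemicontinuousOn u (closure Ω)) (hv : LowerSemicontinuousOn v (closure Ω))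
    (hsub : SpecialLagrangian.IsViscositySubsolution c Ω u)
    (hsuper : SpecialLagrangian.IsViscositySupersolution c Ω v)
    (hbd : ∀ x ∈ frontier Ω, u x ≤ v x) :
    ∀ x ∈ Ω, u x ≤ v x := by
  by_contra! ⟨x₀, hx₀, hlt⟩
  rw [hΩ.frontier_eq] at hbd
  obtain ⟨y, hy, y', hy', φ, ψ, hφ, hψ, hmax, hmin, hD2⟩ :=
    SpecialLagrangian.exists_test_functions_of_lt hΩb.isCompact_closure hΩ subset_closure hu hv
      hbd (subset_closure hx₀) hlt
  have hA := SpecialLagrangian.hessian_isHermitian (x := y) hφ.contDiffAt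
  have hB := SpecialLagrangian.hessian_isHermitian (x := y') hψ.contDiffAt
  have hphase := SpecialLagrangian.phase_lt_phase hn hA hB <|
    SpecialLagrangian.posDef_hessian_sub_hessian hφ.contDiffAt hψ.contDiffAt hD2
  exact hphase.not_ge <|
    (hsuper y' hy' ψ hψ.contDiffAt hmin).trans (hsub y hy φ hφ.contDiffAt hmax)
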